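/- There is an absolute constant $C$ with the following property. Let $E : y^2 = x^3 + Ax + B$ with $A, B \in \mathbb{Z}$ and $4A^3 + 27B^2 \neq 0$ be an elliptic curve over $\mathbb{Q}$. For a squarefree positive integer $D$ let $$E_D : y^2 = x^3 + D^2 A x + D^3 B$$ be its quadratic twist by $D$, and let $r$ be the Mordell–Weil rank of $E_D(\mathbb{Q})$. For a rational point $P$ put $h(P) = \log\max(|a|,|b|)$ if $x(P) = a/b$ in lowest terms, $h(O) = 0$, and let $$\hat h(P) = \lim_{n \to \infty} \frac{h(2^n P)}{4^n}$$ be the canonical height (not normalized by the factor $\tfrac12$). Then there is $D_0$, depending only on $E$, such that for every squarefree positive integer $D \geq D_0$ the set $$\{P \in E_D(\mathbb{Q}) : \hat h(P) \leq 1.5 \log D\}$$ is finite and has at most $C \cdot 4^r$ elements. In particular its subset of integral points (affine points with both coordinates in $\mathbb{Z}$), $$E_D(\mathbb{Z})_{\mathrm{small}} = \{P \in E_D(\mathbb{Z}) : \hat h(P) \leq 1.5 \log D\},$$ is finite and has at most $C \cdot 4^r$ elements. -/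

import Mathlib

noncomputable section

namespace QuadraticTwist

/-- The quadratic twist `E_D : y² = x³ + D²A x + D³B` of `E : y² = x³ + A x + B`, over `ℚ`. -/
def twist (A B D : ℤ) : WeierstrassCurve.Affine ℚ where
  a₁ := 0
  a₂ := 0
  a₃ := 0
  a₄ := (D : ℚ) ^ 2 * (A : ℚ)
  a₆ := (D : ℚ) ^ 3 * (B : ℚ)

/-- The logarithmic Weil height `h(P) = h(x(P))`, with value `0` at the point at infinity.
For `x = a / b` in lowest terms, `Height.logHeight₁ x = log (max |a| |b|)`. -/
def weilHeight {W : WeierstrassCurve.Affine ℚ} : W.Point → ℝ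
  | .zero => 0
  | .some x _ _ => Height.logHeight₁ x

/-- The canonical height `ĥ(P) = lim h(2ⁿ P) / 4ⁿ` (without the factor `1 / 2`). -/
def canonicalHeight {W : WeierstrassCurve.Affine ℚ} (P : W.Point) : ℝ :=
  Filter.limUnder Filter.atTop fun n : ℕ => weilHeight ((2 ^ n : ℕ) • P) / (4 : ℝ) ^ n

/-- An affine point with integral coordinates. -/
def IsIntegralPoint {W : WeierstrassCurve.Affine ℚ} : W.Point → Prop
  | .zero => False
  | .some x y _ => (∃ m : ℤ, x = m) ∧ ∃ n : ℤ, y = n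

/-- The rational points `P` of `E_D` with `ĥ(P) ≤ 1.5 log D`. -/
def smallRationalPoints (A B D : ℤ) : Set (twist A B D).Point :=
  {P | canonicalHeight P ≤ 1.5 * Real.log D}

/-- The integral points `P` of `E_D` with `ĥ(P) ≤ 1.5 log D`. -/
def smallIntegralPoints (A B D : ℤ) : Set (twist A B D).Point :=
  {P | IsIntegralPoint P ∧ canonicalHeight P ≤ 1.5 * Real.log D}

/-- The rank of `E_D(ℚ)`: the maximal number of `ℤ`-linearly independent points. -/
def mordellWeilRank (A B D : ℤ) : Cardinal :=
  Module.rank ℤ (twist A B D).Point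

end QuadraticTwist

end

/-! Over `ℚ(√D)` the twist becomes `E` through x ↦ x/D, so the height of x(P)/D obeys the
parallelogram law up to a constant depending only on `E`, and ĥ lies within that constant of it
(`exists_canonicalHeight_bounds`). If 2P ≠ 0, squarefreeness of D forces this height to be at least
(log D)/4 - O_E(1) (`log_le_untwistedHeight`). Hence ĥ(4z) ≥ 4 log D - O_E(1) whenever 2z ≠ 0, and
for large D all torsion is killed by 2.

Sort the small points by their free coordinates mod 4 and their 2-torsion component: there are at
most 4 · 4^r classes, and distinct points of a class differ by such a 4z. If n points have ĥ ≤ R and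
pairwise differences with ĥ ≥ m, then (n - 1)/n ≤ 2R/m. Here 2R/m is close to 3/4 < 4/5, so n ≤ 4
(`card_le_of_parallelogram`). Only the span of a finite set is decomposed, so the Mordell–Weil
theorem is not needed. -/

namespace QuadraticTwist

/-! ### Quadratic forms from the parallelogram law. -/

section ParallelogramLaw

variable {G : Type*} [AddCommGroup G]

/-- The polar form of a function satisfying the parallelogram law, as a biadditive map. -/
noncomputable def polarForm (q : G → ℝ) (hq : ∀ x y, q (x + y) + q (x - y) = 2 * q x + 2 * q y) :
    G →+ G →+ ℝ :=
  have key (x y z : G) :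
      q (x + y + z) + q x + q y + q z = q (x + y) + q (y + z) + q (x + z) := by
    have h₁ := hq (x + y) z
    have h₂ := hq x (y - z)
    have h₃ := hq (x + z) y
    have h₄ := hq y z
    rw [show x + (y - z) = x + y - z by abel, show x - (y - z) = x + z - y by abel] at h₂
    rw [show x + z + y = x + y + z by abel] at h₃
    linarith
  AddMonoidHom.mk' (fun x ↦ AddMonoidHom.mk' (fun y ↦ q (x + y) - q x - q y) fun y z ↦ by
    have := key x y z
    rw [← add_assoc]
    linarith) fun x y ↦ by
      ext z
      have := key x y z
      simp only [AddMonoidHom.mk'_apply, AddMonoidHom.add_apply]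
      linarith

variable {q : G → ℝ} (hq : ∀ x y, q (x + y) + q (x - y) = 2 * q x + 2 * q y)
include hq

lemma polarForm_apply (x y : G) : polarForm q hq x y = q (x + y) - q x - q y := rfl

lemma polarForm_self (x : G) : polarForm q hq x x = 2 * q x := by
  have h := hq x x
  have h₀ := hq 0 0
  simp only [add_zero, sub_self] at h h₀
  rw [polarForm_apply]
  linarith

lemma map_nsmul_of_parallelogram (n : ℕ) (x : G) : q (n • x) = n ^ 2 * q x := by
  have h := polarForm_self hq (n • x)
  simp only [map_nsmul, AddMonoidHom.nsmul_apply, polarForm_self hq, nsmul_eq_mul] at h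
  linarith

lemma map_sub_of_parallelogram (x y : G) : q (x - y) = q x + q y - polarForm q hq x y := by
  rw [polarForm_apply]
  linarith [hq x y]

lemma sum_sum_map_sub (s : Finset G) :
    ∑ x ∈ s, ∑ y ∈ s, q (x - y) = 2 * s.card * ∑ x ∈ s, q x - 2 * q (∑ x ∈ s, x) := by
  rw [← polarForm_self hq (∑ x ∈ s, x)]
  simp only [map_sub_of_parallelogram hq, Finset.sum_sub_distrib, Finset.sum_add_distrib, map_sum,
    Finset.sum_const, nsmul_eq_mul, AddMonoidHom.finsetSum_apply, ← Finset.mul_sum]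
  rw [Finset.sum_comm (f := fun x y ↦ polarForm q hq x y)]
  ring

/-- A set of vectors in a ball whose differences are long is small. -/
lemma card_mul_card_sub_one_mul_le (hq₀ : ∀ x, 0 ≤ q x) (s : Finset G) {m R : ℝ}
    (hm : ∀ x ∈ s, ∀ y ∈ s, x ≠ y → m ≤ q (x - y)) (hR : ∀ x ∈ s, q x ≤ R) :
    (s.card : ℝ) * (s.card - 1) * m ≤ 2 * s.card ^ 2 * R := by
  classical
  have h₁ : ∑ x ∈ s, q x ≤ s.card * R := by
    simpa using Finset.sum_le_sum hR
  have h₂ : (s.card : ℝ) * (s.card - 1) * m ≤ ∑ x ∈ s, ∑ y ∈ s, q (x - y) := by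
    have : ∀ x ∈ s, ((s.card : ℝ) - 1) * m ≤ ∑ y ∈ s, q (x - y) := by
      intro x hx
      rw [← Finset.add_sum_erase _ _ hx]
      have h := Finset.sum_le_sum (s := s.erase x) (f := fun _ ↦ m) (g := fun y ↦ q (x - y))
        fun y hy ↦ hm x hx y (Finset.mem_of_mem_erase hy) (Finset.ne_of_mem_erase hy).symm
      rw [Finset.sum_const, nsmul_eq_mul, Finset.cast_card_erase_of_mem hx] at h
      linarith [hq₀ (x - x)]
    simpa [mul_assoc] using Finset.sum_le_sum this
  rw [sum_sum_map_sub hq] at h₂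
  -- The term `2 * q (∑ x)` of the identity is nonnegative and is dropped.
  nlinarith [hq₀ (∑ x ∈ s, x), mul_le_mul_of_nonneg_left h₁ (Nat.cast_nonneg (α := ℝ) s.card)]

end ParallelogramLaw

/-! ### Tate's limit argument. -/

section Limit

open Filter Topology

variable {G : Type*} [AddCommGroup G] {h : G → ℝ} {C : ℝ}

/-- The existence of the limit defining the canonical height, with its distance to the original
height. -/
lemma exists_tendsto_of_approx_parallelogram (h₀ : h 0 = 0)
    (hC : ∀ x y, |h (x + y) + h (x - y) - 2 * h x - 2 * h y| ≤ C) (x : G) :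
    ∃ l, Tendsto (fun n : ℕ ↦ h ((2 ^ n : ℕ) • x) / (4 : ℝ) ^ n) atTop (𝓝 l) ∧ |h x - l| ≤ C := by
  set f : ℕ → ℝ := fun n ↦ h ((2 ^ n : ℕ) • x) / (4 : ℝ) ^ n with hf
  -- The approximate law at x = y bounds |h(2x) - 4h(x)| by `C`; the geometric series then sums to
  -- C/3 ≤ C.
  have hstep (n : ℕ) : dist (f n) (f (n + 1)) ≤ C / 4 * (1 / 4) ^ n := by
    have key := hC ((2 ^ n : ℕ) • x) ((2 ^ n : ℕ) • x)
    rw [sub_self, h₀, ← add_smul, ← two_mul, ← pow_succ'] at key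
    have h4 : (0 : ℝ) < 4 ^ n := by positivity
    have : f n - f (n + 1) =
        -(h ((2 ^ (n + 1) : ℕ) • x) + 0 - 2 * h ((2 ^ n : ℕ) • x) - 2 * h ((2 ^ n : ℕ) • x))
          * (1 / 4) * (1 / 4) ^ n := by
      simp only [hf, one_div, inv_pow, pow_succ (4 : ℝ)]
      field_simp
      ring
    rw [Real.dist_eq, this, abs_mul, abs_mul, abs_neg, abs_of_nonneg (by positivity : (0:ℝ) ≤ 1 / 4),
      abs_of_nonneg (by positivity : (0:ℝ) ≤ (1 / 4) ^ n)]
    have : (0 : ℝ) ≤ (1 / 4) ^ n := by positivity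
    nlinarith
  obtain ⟨l, hl⟩ := cauchySeq_tendsto_of_complete
    (cauchySeq_of_le_geometric (1 / 4) (C / 4) (by norm_num) hstep)
  refine ⟨l, hl, ?_⟩
  have := dist_le_of_le_geometric_of_tendsto₀ (1 / 4) (C / 4) (by norm_num) hstep hl
  have hC₀ : 0 ≤ C := (abs_nonneg _).trans (hC x x)
  rw [Real.dist_eq] at this
  simp only [hf, pow_zero, one_smul, div_one] at this
  refine this.trans ?_
  rw [div_div, div_le_iff₀ (by norm_num)]
  linarith

lemma parallelogram_of_tendsto {q : G → ℝ}
    (hC : ∀ x y, |h (x + y) + h (x - y) - 2 * h x - 2 * h y| ≤ C)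
    (hq : ∀ x, Tendsto (fun n : ℕ ↦ h ((2 ^ n : ℕ) • x) / (4 : ℝ) ^ n) atTop (𝓝 (q x))) (x y : G) :
    q (x + y) + q (x - y) = 2 * q x + 2 * q y := by
  have hlim := (((hq (x + y)).add (hq (x - y))).sub ((hq x).const_mul 2)).sub ((hq y).const_mul 2)
  have hzero : Tendsto (fun n : ℕ ↦ C / (4 : ℝ) ^ n) atTop (𝓝 0) :=
    tendsto_const_nhds.div_atTop (tendsto_pow_atTop_atTop_of_one_lt (by norm_num))
  have := tendsto_nhds_unique hlim (squeeze_zero_norm (fun n ↦ ?_) hzero)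
  · linarith
  have key := hC ((2 ^ n : ℕ) • x) ((2 ^ n : ℕ) • y)
  rw [← smul_add, ← smul_sub] at key
  have h4 : (0 : ℝ) < 4 ^ n := by positivity
  rw [Real.norm_eq_abs, ← abs_of_pos h4, ← mul_div_assoc, ← mul_div_assoc, ← add_div, ← sub_div,
    ← sub_div, abs_div, abs_abs]
  gcongr

end Limit

end QuadraticTwist

/-! ### Addition on the twist in the coordinate x/D of the untwisted curve. -/

namespace QuadraticTwist

open WeierstrassCurve WeierstrassCurve.Affine Height

variable {A B D : ℤ}

lemma twist_negY (x y : ℚ) : (twist A B D).negY x y = -y := by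
  simp [negY, twist]

lemma twist_equation {x y : ℚ} (h : (twist A B D).Nonsingular x y) :
    y ^ 2 = x ^ 3 + D ^ 2 * A * x + D ^ 3 * B := by
  simpa [twist, equation_iff] using h.1

lemma isElliptic_twist_one (h : 4 * A ^ 3 + 27 * B ^ 2 ≠ 0) : (twist A B 1).IsElliptic := by
  refine ⟨isUnit_iff_ne_zero.mpr ?_⟩
  have : (twist A B 1).Δ = ((-16 * (4 * A ^ 3 + 27 * B ^ 2) : ℤ) : ℚ) := by
    simp only [twist, Δ, b₂, b₄, b₆, b₈]
    push_cast
    ring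
  rw [this]
  exact_mod_cast mul_ne_zero (by norm_num) h

/-- Projective coordinates of `x(P) / D`, the `x`-coordinate of the image of `P` in the
untwisted curve over `ℚ(√D)`. -/
def untwistedX : (twist A B D).Point → Fin 2 → ℚ
  | .zero => ![1, 0]
  | .some x _ _ => ![x / D, 1]

lemma untwistedX_zero : untwistedX (0 : (twist A B D).Point) = ![1, 0] := rfl

lemma untwistedX_some {x y : ℚ} (h : (twist A B D).Nonsingular x y) :
    untwistedX (.some x y h) = ![x / D, 1] := rfl

lemma untwistedX_ne_zero (P : (twist A B D).Point) : untwistedX P ≠ 0 := by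
  cases P <;> simp [untwistedX]

lemma untwistedX_neg (P : (twist A B D).Point) : untwistedX (-P) = untwistedX P := by
  cases P <;> rfl

/-- The symmetric square of `untwistedX`. -/
def untwistedSym2 (P Q : (twist A B D).Point) : Fin 3 → ℚ :=
  ![untwistedX P 0 * untwistedX Q 0, untwistedX P 0 * untwistedX Q 1 + untwistedX P 1 * untwistedX Q 0,
    untwistedX P 1 * untwistedX Q 1]

lemma addSubMap_twist_one_eval (s t u : ℚ) :
    (fun i ↦ (addSubMap (twist A B 1) i).eval ![s, t, u]) =
      ![s ^ 2 - 2 * A * s * u - 4 * B * t * u + A ^ 2 * u ^ 2,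
        2 * t * s + 2 * A * t * u + 4 * B * u ^ 2, t ^ 2 - 4 * s * u] := by
  ext i
  fin_cases i <;> simp [addSubMap, twist, b₂, b₄, b₆, b₈]

lemma untwistedX_add_of_X_ne {x₁ y₁ x₂ y₂ : ℚ} (h₁ : (twist A B D).Nonsingular x₁ y₁)
    (h₂ : (twist A B D).Nonsingular x₂ y₂) (hx : x₁ ≠ x₂) :
    untwistedX (Point.some _ _ h₁ + .some _ _ h₂) =
      ![(((y₁ - y₂) / (x₁ - x₂)) ^ 2 - x₁ - x₂) / D, 1] := by
  rw [Point.add_of_X_ne hx, untwistedX_some, addX, slope_of_X_ne hx]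
  simp [twist]

lemma untwistedX_sub_of_X_ne {x₁ y₁ x₂ y₂ : ℚ} (h₁ : (twist A B D).Nonsingular x₁ y₁)
    (h₂ : (twist A B D).Nonsingular x₂ y₂) (hx : x₁ ≠ x₂) :
    untwistedX (Point.some _ _ h₁ - .some _ _ h₂) =
      ![(((y₁ + y₂) / (x₁ - x₂)) ^ 2 - x₁ - x₂) / D, 1] := by
  rw [sub_eq_add_neg, Point.neg_some, untwistedX_add_of_X_ne _ _ hx, twist_negY, sub_neg_eq_add]

lemma untwistedX_add_self {x y : ℚ} (h : (twist A B D).Nonsingular x y) (hy : y ≠ 0) :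
    untwistedX (Point.some _ _ h + .some _ _ h) =
      ![(((3 * x ^ 2 + D ^ 2 * A) / (2 * y)) ^ 2 - 2 * x) / D, 1] := by
  have hne : y ≠ (twist A B D).negY x y := by
    rw [twist_negY]
    intro h'
    exact hy (by linarith)
  rw [Point.add_self_of_Y_ne hne, untwistedX_some, slope_of_Y_ne rfl hne, twist_negY]
  congr 2
  simp only [addX, twist]
  ring

lemma some_add_self_eq_zero {x : ℚ} (h : (twist A B D).Nonsingular x 0) :
    Point.some _ _ h + .some _ _ h = 0 :=
  Point.add_self_of_Y_eq (by rw [twist_negY, neg_zero])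

lemma exists_addSubMap_zero (P : (twist A B D).Point) :
    ∃ c : ℚ, c ≠ 0 ∧ (fun i ↦ (addSubMap (twist A B 1) i).eval (untwistedSym2 P 0)) =
      c • untwistedSym2 P P := by
  refine ⟨1, one_ne_zero, ?_⟩
  rw [untwistedSym2, addSubMap_twist_one_eval]
  cases P <;> ext i <;> fin_cases i <;> simp [untwistedSym2, untwistedX] <;> ring

lemma exists_addSubMap_self (hD : D ≠ 0) (P : (twist A B D).Point) :
    ∃ c : ℚ, c ≠ 0 ∧ (fun i ↦ (addSubMap (twist A B 1) i).eval (untwistedSym2 P P)) =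
      c • untwistedSym2 (P + P) 0 := by
  have hD' : (D : ℚ) ≠ 0 := mod_cast hD
  match P with
  | 0 => simpa using exists_addSubMap_zero (0 : (twist A B D).Point)
  | .some x y h =>
    have e := twist_equation h
    rcases eq_or_ne y 0 with rfl | hy
    · have hns : 3 * x ^ 2 + D ^ 2 * A ≠ 0 := by
        have := (nonsingular_iff (W := twist A B D) x 0).mp h
        simp only [twist] at this
        intro h'
        rcases this.2 with h₁ | h₁ <;> apply h₁ <;> linarith
      -- Here P + P = 0, so the target is (1 : 0 : 0); nonsingularity makes the scalar nonzero.
      refine ⟨((3 * x ^ 2 + D ^ 2 * A) / D ^ 2) ^ 2, by positivity, ?_⟩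
      rw [untwistedSym2, addSubMap_twist_one_eval, untwistedSym2, some_add_self_eq_zero]
      ext i
      fin_cases i
      · simp [untwistedX]
        field_simp
        linear_combination (8 * x) * e
      · simp [untwistedX]
        field_simp
        linear_combination (-4) * e
      · simp [untwistedX]
        ring
    · refine ⟨4 * y ^ 2 / D ^ 3, by positivity, ?_⟩
      rw [untwistedSym2, addSubMap_twist_one_eval, untwistedSym2, untwistedX_add_self h hy]
      ext i
      fin_cases i
      · simp [untwistedX]
        field_simp
        rw [e]
        ring
      · simp [untwistedX]
        field_simp
        rw [e]
        ring
      · simp [untwistedX]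
        ring

lemma exists_addSubMap_of_X_ne (hD : D ≠ 0) {x₁ y₁ x₂ y₂ : ℚ} (h₁ : (twist A B D).Nonsingular x₁ y₁)
    (h₂ : (twist A B D).Nonsingular x₂ y₂) (hx : x₁ ≠ x₂) :
    ∃ c : ℚ, c ≠ 0 ∧ (fun i ↦ (addSubMap (twist A B 1) i).eval
        (untwistedSym2 (.some _ _ h₁) (.some _ _ h₂))) =
      c • untwistedSym2 (Point.some _ _ h₁ + .some _ _ h₂) (Point.some _ _ h₁ - .some _ _ h₂) := by
  have hD' : (D : ℚ) ≠ 0 := mod_cast hD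
  have e₁ := twist_equation h₁
  have e₂ := twist_equation h₂
  have hx' : x₁ - x₂ ≠ 0 := sub_ne_zero.mpr hx
  refine ⟨(x₁ / D - x₂ / D) ^ 2, by rw [← sub_div]; positivity, ?_⟩
  rw [untwistedSym2, addSubMap_twist_one_eval, untwistedSym2, untwistedX_add_of_X_ne h₁ h₂ hx,
    untwistedX_sub_of_X_ne h₁ h₂ hx]
  simp only [untwistedX_some]
  -- Solving the two curve equations for `A` and `B` turns the claim into an identity of rational
  -- functions in the coordinates and `D`.
  have hA' : (A : ℚ) = (y₁ ^ 2 - y₂ ^ 2 - x₁ ^ 3 + x₂ ^ 3) / (D ^ 2 * (x₁ - x₂)) := by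
    field_simp
    linarith
  have hB' : (B : ℚ) = (y₁ ^ 2 - x₁ ^ 3 - D ^ 2 * A * x₁) / D ^ 3 := by
    field_simp
    linarith
  rw [hB', hA']
  ext i
  fin_cases i
  · simp
    field_simp
    ring
  · simp
    field_simp
    ring
  · simp
    ring

lemma exists_addSubMap_eq_smul (hD : D ≠ 0) (P Q : (twist A B D).Point) :
    ∃ c : ℚ, c ≠ 0 ∧ (fun i ↦ (addSubMap (twist A B 1) i).eval (untwistedSym2 P Q)) =
      c • untwistedSym2 (P + Q) (P - Q) := by
  have hcomm (P Q : (twist A B D).Point) : untwistedSym2 P Q = untwistedSym2 Q P := by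
    simp only [untwistedSym2]
    congr 1
    · ring
    · congr 1
      · ring
      · congr 1
        ring
  have hneg (P Q : (twist A B D).Point) : untwistedSym2 P (-Q) = untwistedSym2 P Q := by
    simp only [untwistedSym2, untwistedX_neg]
  match P, Q with
  | P, 0 => simpa using exists_addSubMap_zero P
  | 0, Q => simpa [hcomm 0 Q, hneg] using exists_addSubMap_zero Q
  | .some x₁ y₁ h₁, .some x₂ y₂ h₂ =>
    by_cases hx : x₁ = x₂
    · rcases Point.X_eq_iff.mp hx with h | h
      · rw [h, sub_self]
        exact exists_addSubMap_self hD _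
      -- When Q = -P, symmetry and evenness reduce to the case of equal points.
      · rw [eq_neg_iff_add_eq_zero] at h
        rw [h, hcomm 0, ← hneg, ← eq_neg_of_add_eq_zero_left h, sub_eq_add_neg,
          ← eq_neg_of_add_eq_zero_left h]
        exact exists_addSubMap_self hD _
    · exact exists_addSubMap_of_X_ne hD h₁ h₂ hx

/-! ### Heights, uniformly in D. -/

/-- The Weil height of `x(P) / D`. -/
noncomputable def untwistedHeight (P : (twist A B D).Point) : ℝ := logHeight (untwistedX P)

lemma untwistedHeight_zero : untwistedHeight (0 : (twist A B D).Point) = 0 := by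
  rw [untwistedHeight, untwistedX_zero, logHeight_swap, ← logHeight₁_eq_logHeight, logHeight₁_zero]

lemma untwistedHeight_some {x y : ℚ} (h : (twist A B D).Nonsingular x y) :
    untwistedHeight (.some _ _ h) = logHeight₁ (x / D) := by
  rw [untwistedHeight, untwistedX_some, logHeight₁_eq_logHeight]

/-- The approximate parallelogram law, uniformly in the twisting parameter. -/
theorem exists_approx_parallelogram (A B : ℤ) (h : 4 * A ^ 3 + 27 * B ^ 2 ≠ 0) :
    ∃ C : ℝ, ∀ D : ℤ, D ≠ 0 → ∀ P Q : (twist A B D).Point,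
      |untwistedHeight (P + Q) + untwistedHeight (P - Q) - 2 * untwistedHeight P
        - 2 * untwistedHeight Q| ≤ C := by
  have := isElliptic_twist_one h
  obtain ⟨C₁, h₁⟩ := abs_logHeight_addSubMap_sub_two_mul_logHeight_le (twist A B 1)
  obtain ⟨C₂, h₂⟩ := abs_logHeight_sym2_sub_le ℚ
  refine ⟨C₁ + 3 * C₂, fun D hD P Q ↦ ?_⟩
  have hs (P Q : (twist A B D).Point) :
      |logHeight (untwistedSym2 P Q) - (untwistedHeight P + untwistedHeight Q)| ≤ C₂ := by
    have eta (R : (twist A B D).Point) : ![untwistedX R 0, untwistedX R 1] = untwistedX R := by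
      ext i
      fin_cases i <;> rfl
    have := h₂ (a := untwistedX P 0) (b := untwistedX P 1) (c := untwistedX Q 0)
      (d := untwistedX Q 1)
    rw [eta, eta] at this
    exact this (untwistedX_ne_zero P) (untwistedX_ne_zero Q)
  obtain ⟨c, hc, hcs⟩ := exists_addSubMap_eq_smul hD P Q
  have k₁ := h₁ (untwistedSym2 P Q)
  rw [hcs, logHeight_smul_eq_logHeight _ hc] at k₁
  have k₂ := hs P Q
  have k₃ := hs (P + Q) (P - Q)
  rw [abs_le] at *
  constructor <;> linarith

lemma abs_weilHeight_sub_untwistedHeight_le (hD : D ≠ 0) (P : (twist A B D).Point) :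
    |weilHeight P - untwistedHeight P| ≤ logHeight₁ (D : ℚ) := by
  have hD' : (D : ℚ) ≠ 0 := mod_cast hD
  match P with
  | 0 =>
    rw [untwistedHeight_zero]
    simpa [weilHeight, ← Point.zero_def] using zero_le_logHeight₁ (D : ℚ)
  | .some x y h =>
    rw [untwistedHeight_some, weilHeight, abs_le]
    have h₁ := logHeight₁_mul_le (x / D) (D : ℚ)
    have h₂ := logHeight₁_mul_le x (D : ℚ)⁻¹
    rw [div_mul_cancel₀ _ hD'] at h₁
    rw [logHeight₁_inv, ← div_eq_mul_inv] at h₂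
    constructor <;> linarith

/-- The square of the denominator of `w` divides D · num², hence divides `D` by coprimality, so it
is 1. -/
lemma exists_int_of_squarefree_mul_sq {D N : ℤ} (hD : Squarefree D) {w : ℚ} (h : D * w ^ 2 = N) :
    ∃ n : ℤ, w = n := by
  have hb : (w.den : ℤ) * w.den ∣ D := by
    have : D * w.num ^ 2 = (w.den : ℤ) ^ 2 * N := by
      have hw : (w.den : ℚ) ≠ 0 := mod_cast w.den_nz
      rw [← Rat.num_div_den w] at h
      field_simp at h
      exact_mod_cast h
    rw [← sq]
    refine IsCoprime.dvd_of_dvd_mul_right (z := w.num ^ 2) ?_ ⟨N, this⟩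
    exact (Int.isCoprime_iff_gcd_eq_one.mpr (by
      simpa [Int.gcd] using w.reduced.symm)).pow
  have h1 := hD _ hb
  refine ⟨w.num, ?_⟩
  have : w.den = 1 := by simpa [Int.isUnit_iff] using h1
  exact (Rat.coe_int_num_of_den_eq_one this).symm

/-- Points that are not `2`-torsion have large height on a twist by a large `D`. -/
theorem log_le_untwistedHeight (hD : 0 < D) (hsq : Squarefree D) {P : (twist A B D).Point}
    (hP : P + P ≠ 0) : Real.log D ≤ 4 * untwistedHeight P + Real.log (1 + |A| + |B|) := by
  have hD' : (D : ℚ) ≠ 0 := mod_cast hD.ne'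
  match P with
  | 0 => simp at hP
  | .some x y h =>
    have hy : y ≠ 0 := by
      rintro rfl
      exact hP (some_add_self_eq_zero h)
    have e := twist_equation h
    rw [untwistedHeight_some, Rat.logHeight₁_eq_log_max]
    obtain ⟨X, rfl⟩ : ∃ X, x = D * X := ⟨x / D, by field_simp⟩
    rw [mul_div_cancel_left₀ _ hD']
    set u := X.num
    set v : ℤ := (X.den : ℤ) with hvdef
    have hv : (0 : ℤ) < v := by
      rw [hvdef]
      exact_mod_cast X.den_pos
    have hvQ : (v : ℚ) ≠ 0 := mod_cast hv.ne'
    have hXuv : X = u / v := (Rat.num_div_den X).symm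
    set N : ℤ := v * (u ^ 3 + A * u * v ^ 2 + B * v ^ 3) with hN
    -- The curve equation multiplied by v⁴/D³, with x = D·u/v. Then D ≤ D·n² = |N|, and `N` is a
    -- quartic form in (u, v).
    have hw : (D : ℚ) * (v ^ 2 * y / D ^ 2) ^ 2 = N := by
      rw [hXuv] at e
      field_simp at e ⊢
      rw [hN]
      push_cast
      linear_combination (v:ℚ) * e
    obtain ⟨n, hn⟩ := exists_int_of_squarefree_mul_sq hsq hw
    have hn0 : n ≠ 0 := by
      rintro rfl
      have : (v : ℚ) ^ 2 * y / D ^ 2 ≠ 0 := by positivity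
      exact this (by simpa using hn)
    rw [hn] at hw
    have hDn : D * n ^ 2 = N := mod_cast hw
    have hDN : D ≤ |N| := by
      rw [← hDn, abs_mul, abs_of_pos hD, abs_of_nonneg (sq_nonneg n)]
      exact le_mul_of_one_le_right hD.le (by positivity : 0 < n ^ 2)
    set H : ℕ := max u.natAbs X.den with hH
    have hu : |u| ≤ H := by
      rw [Int.abs_eq_natAbs]
      exact_mod_cast le_max_left _ _
    have hv' : |v| ≤ H := by
      rw [abs_of_pos hv, hvdef]
      exact_mod_cast le_max_right _ _
    have hH0 : 0 < H := lt_max_of_lt_right X.den_pos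
    have hNH : |N| ≤ (H : ℤ) ^ 4 * (1 + |A| + |B|) := by
      calc |N| = |v| * |u ^ 3 + A * u * v ^ 2 + B * v ^ 3| := by rw [hN, abs_mul]
        _ ≤ |v| * (|u| ^ 3 + |A| * |u| * |v| ^ 2 + |B| * |v| ^ 3) := by
          gcongr
          refine (abs_add_three _ _ _).trans_eq ?_
          simp only [abs_mul, abs_pow]
        _ ≤ H * (H ^ 3 + |A| * H * H ^ 2 + |B| * H ^ 3) := by gcongr
        _ = _ := by ring
    have hfin : (D : ℝ) ≤ (H : ℝ) ^ 4 * (1 + |A| + |B|) := by exact_mod_cast hDN.trans hNH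
    have hH' : (0 : ℝ) < H := mod_cast hH0
    have hAB : (0 : ℝ) < 1 + |(A : ℝ)| + |(B : ℝ)| := by positivity
    push_cast at hfin ⊢
    refine (Real.log_le_log (mod_cast hD) hfin).trans_eq ?_
    rw [Real.log_mul (by positivity) (by positivity), Real.log_pow]
    push_cast
    rfl

end QuadraticTwist

namespace QuadraticTwist

open WeierstrassCurve WeierstrassCurve.Affine Height Filter Topology

/-! ### Counting short vectors modulo 4. -/

section Counting

variable {G : Type*} [AddCommGroup G] {q : G → ℝ}

/-- If n • x = 0 then n² q(x) = q(0) = 0, which the lower bound `c` excludes unless 2x = 0. -/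
lemma add_self_eq_zero_of_isOfFinAddOrder
    (hq : ∀ x y, q (x + y) + q (x - y) = 2 * q x + 2 * q y) {c : ℝ} (hc : 0 < c)
    (hlow : ∀ x, x + x ≠ 0 → c ≤ q x) {x : G} (hx : IsOfFinAddOrder x) : x + x = 0 := by
  by_contra hne
  obtain ⟨n, hn, hnx⟩ := isOfFinAddOrder_iff_nsmul_eq_zero.mp hx
  have h₁ := map_nsmul_of_parallelogram hq n x
  have h₀ := hq 0 0
  rw [hnx] at h₁
  simp only [add_zero, sub_zero] at h₀
  have : (0 : ℝ) < n ^ 2 * q x := mul_pos (by positivity) (hc.trans_le (hlow x hne))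
  linarith

/-- A finitely generated abelian group whose torsion is killed by `2` maps to
`(ℤ/4)^r × G[2]` so that the differences in a fibre are divisible by `4`. -/
lemma exists_map_sub_eq_four_nsmul (M : Submodule ℤ G) [Module.Finite ℤ M]
    (hT : ∀ x : G, IsOfFinAddOrder x → x + x = 0) :
    ∃ (s : ℕ) (F : M → (Fin s → ZMod 4) × {x : G | x + x = 0}),
      (s : Cardinal) ≤ Module.rank ℤ G ∧ ∀ x y, F x = F y → ∃ z : G, (x - y : G) = 4 • z := by
  let T := Submodule.torsion ℤ M
  -- The torsion-free quotient is free, so it splits off; x - σ(x mod T) is the torsion component.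
  obtain ⟨σ, hσ⟩ := Module.projective_lifting_property T.mkQ LinearMap.id T.mkQ_surjective
  have hσ' (v : M ⧸ T) : T.mkQ (σ v) = v := LinearMap.congr_fun hσ v
  let b := Module.finBasis ℤ (M ⧸ T)
  have htors (x : M) : (x - σ (T.mkQ x) : G) + (x - σ (T.mkQ x)) = 0 := by
    have hmem : x - σ (T.mkQ x) ∈ T := by
      rw [← Submodule.Quotient.mk_eq_zero, ← Submodule.mkQ_apply, map_sub, hσ', sub_self]
    obtain ⟨a, ha⟩ := (Submodule.mem_torsion_iff _).mp hmem
    apply hT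
    rw [isOfFinAddOrder_iff_zsmul_eq_zero]
    refine ⟨a, nonZeroDivisors.coe_ne_zero a, ?_⟩
    simpa only [Submodule.coe_smul, Submodule.coe_sub] using! congrArg Subtype.val ha
  refine ⟨_, fun x ↦ (fun i ↦ (b.repr (T.mkQ x) i : ZMod 4), ⟨_, htors x⟩), ?_, fun x y hxy ↦ ?_⟩
  · rw [Module.finrank_eq_rank]
    exact (rank_quotient_le T).trans (Submodule.rank_le M)
  · simp only [Prod.mk.injEq, Subtype.mk.injEq] at hxy
    have hdvd (i) : ∃ k : ℤ, b.repr (T.mkQ x) i - b.repr (T.mkQ y) i = 4 * k := by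
      have := (ZMod.intCast_eq_intCast_iff_dvd_sub _ _ _).mp (congrFun hxy.1 i).symm
      exact_mod_cast this
    choose k hk using hdvd
    set v := b.equivFun.symm k
    have hv : T.mkQ x - T.mkQ y = 4 • v := by
      apply b.repr.injective
      ext i
      rw [map_sub, map_nsmul, Finsupp.sub_apply, Finsupp.smul_apply, hk, ← b.equivFun_apply v,
        b.equivFun.apply_symm_apply]
      simp
    refine ⟨σ v, ?_⟩
    have : (σ (T.mkQ x) - σ (T.mkQ y) : G) = 4 • (σ v : G) := by
      rw [← Submodule.coe_sub, ← map_sub, hv, map_nsmul]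
      rfl
    rw [← this, ← sub_eq_zero, ← sub_eq_zero.mpr hxy.2]
    abel

theorem card_le_of_parallelogram (hq : ∀ x y, q (x + y) + q (x - y) = 2 * q x + 2 * q y)
    (hq₀ : ∀ x, 0 ≤ q x) {c R : ℝ} (hc : 0 < c) (hlow : ∀ x, x + x ≠ 0 → c ≤ q x)
    (hR : 5 * R < 32 * c) (hfin : {x : G | x + x = 0}.Finite) (hcard : {x : G | x + x = 0}.ncard ≤ 4)
    (S : Finset G) (hS : ∀ x ∈ S, q x ≤ R) : (S.card : Cardinal) ≤ 64 * 4 ^ Module.rank ℤ G := by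
  classical
  obtain ⟨s, F, hs, hF⟩ := exists_map_sub_eq_four_nsmul (Submodule.span ℤ (S : Set G))
    fun x hx ↦ add_self_eq_zero_of_isOfFinAddOrder hq hc hlow hx
  have := hfin.fintype
  let f : S → (Fin s → ZMod 4) × {x : G | x + x = 0} := fun x ↦ F ⟨x, Submodule.subset_span x.2⟩
  -- Five points would give 20 · 16c ≤ 50R, that is 32c ≤ 5R, against `hR`.
  have hfib (t) : (Finset.univ.filter fun x ↦ f x = t).card ≤ 4 := by
    by_contra! hlt
    obtain ⟨U, hU, hU5⟩ := Finset.exists_subset_card_eq (Nat.succ_le_of_lt hlt)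
    have := card_mul_card_sub_one_mul_le hq hq₀ (U.map (Function.Embedding.subtype _)) (m := 16 * c)
      (R := R) ?_ ?_
    · rw [Finset.card_map, hU5] at this
      norm_num at this
      linarith
    · simp only [Finset.mem_map, forall_exists_index, and_imp]
      rintro _ x hx rfl _ y hy rfl hne
      have hfx := (Finset.mem_filter.mp (hU hx)).2
      have hfy := (Finset.mem_filter.mp (hU hy)).2
      obtain ⟨z, hz⟩ := hF _ _ (hfx.trans hfy.symm)
      simp only [Function.Embedding.subtype_apply] at hz hne ⊢
      have hz2 : z + z ≠ 0 := by
        intro h0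
        rw [show 4 • z = (z + z) + (z + z) by abel, h0, add_zero, sub_eq_zero] at hz
        exact hne hz
      rw [hz, map_nsmul_of_parallelogram hq]
      norm_num
      exact hlow z hz2
    · simp only [Finset.mem_map, forall_exists_index, and_imp]
      rintro _ x hx rfl
      exact hS x x.2
  -- Four points per fibre, 4^s residues and four torsion values already give 16 · 4^s.
  have hle : S.card ≤ 64 * 4 ^ s := by
    have h₁ := Finset.card_le_mul_card_image_of_maps_to (f := f) (s := Finset.univ)
      (t := Finset.univ) (fun _ _ ↦ Finset.mem_univ _) 4 fun t _ ↦ hfib t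
    have h₂ : Fintype.card {x : G | x + x = 0} ≤ 4 := by
      rwa [← Nat.card_eq_fintype_card]
    simp only [Finset.card_univ, Fintype.card_coe, Fintype.card_prod, Fintype.card_fun,
      ZMod.card, Fintype.card_fin] at h₁
    nlinarith [pow_pos (show 0 < 4 by norm_num) s]
  calc (S.card : Cardinal) ≤ ((64 * 4 ^ s : ℕ) : Cardinal) := by exact_mod_cast hle
    _ = 64 * 4 ^ (s : Cardinal) := by push_cast; rw [Cardinal.power_natCast]
    _ ≤ _ := by
      gcongr
      exact Cardinal.power_le_power_left (by norm_num) hs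

end Counting

/-! ### Northcott finiteness, 2-torsion and the canonical height. -/

variable {A B D : ℤ}

lemma finite_weilHeight_le (b : ℝ) : {P : (twist A B D).Point | weilHeight P ≤ b}.Finite := by
  have hfin : (insert ![1, 0] ((fun x : ℚ ↦ ![x, 1]) '' {x | logHeight₁ x ≤ b})).Finite :=
    ((NumberField.finite_setOfPred_logHeight₁_le ℚ b).image _).insert _
  refine (hfin.preimage' (f := Point.xRep (W' := twist A B D)) fun v _ ↦ ?_).subset ?_
  · rcases (Point.xRep (W' := twist A B D) ⁻¹' {v}).eq_empty_or_nonempty with h | ⟨P, hP⟩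
    · rw [h]
      exact Set.finite_empty
    · refine (Set.toFinite {P, -P}).subset fun Q hQ ↦ ?_
      exact Point.xRep_eq_xRep_iff.mp (Eq.trans hQ hP.symm)
  · rintro (_ | ⟨x, y, h⟩) hP
    · exact Or.inl rfl
    · exact Or.inr ⟨x, hP, rfl⟩

open Polynomial in
lemma finite_and_ncard_two_torsion_le :
    {P : (twist A B D).Point | P + P = 0}.Finite ∧ {P : (twist A B D).Point | P + P = 0}.ncard ≤ 4 := by
  classical
  let p : ℚ[X] := X ^ 3 + C ((D : ℚ) ^ 2 * A) * X + C ((D : ℚ) ^ 3 * B)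
  have hdeg : p.natDegree = 3 := by
    simp only [p]
    compute_degree!
  have hp : p ≠ 0 := by
    intro h
    simp [h] at hdeg
  let U : Finset (Fin 2 → ℚ) := insert ![1, 0] (p.roots.toFinset.image fun x ↦ ![x, 1])
  have hU : U.card ≤ 4 := by
    refine (Finset.card_insert_le _ _).trans (Nat.succ_le_succ ?_)
    exact Finset.card_image_le.trans ((Multiset.toFinset_card_le _).trans (hdeg ▸ p.card_roots'))
  have hmaps : ∀ P ∈ {P : (twist A B D).Point | P + P = 0}, P.xRep ∈ (U : Set (Fin 2 → ℚ)) := by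
    rintro (_ | ⟨x, y, h⟩) hP
    · simp [U, Point.xRep]
    · have hy : y = 0 := by
        have := eq_neg_of_add_eq_zero_left (show Point.some x y h + .some x y h = 0 from hP)
        simp only [Point.neg_some, Point.some.injEq, true_and, twist_negY] at this
        linarith
      have e := twist_equation h
      simp only [U, Finset.coe_insert, Finset.coe_image, Point.xRep_some]
      refine Or.inr ⟨x, ?_, rfl⟩
      simp only [Finset.mem_coe, Multiset.mem_toFinset, mem_roots hp, IsRoot.def, p]
      simp [hy] at e ⊢
      linarith
  have hinj : Set.InjOn (Point.xRep (W' := twist A B D)) {P | P + P = 0} := by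
    intro P _ Q hQ hPQ
    rcases Point.xRep_eq_xRep_iff.mp hPQ with h | h
    · exact h
    · rw [h, neg_eq_of_add_eq_zero_left hQ]
  refine ⟨Set.Finite.of_finite_image (U.finite_toSet.subset (Set.image_subset_iff.mpr hmaps)) hinj, ?_⟩
  have := Set.ncard_le_ncard_of_injOn _ hmaps hinj U.finite_toSet
  rw [Set.ncard_coe_finset] at this
  omega

/-- The canonical height is a quadratic form at bounded distance from the height of `x(P) / D`,
uniformly in `D`. -/
theorem exists_canonicalHeight_bounds (A B : ℤ) (h : 4 * A ^ 3 + 27 * B ^ 2 ≠ 0) :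
    ∃ C : ℝ, ∀ D : ℤ, D ≠ 0 →
      (∀ P Q : (twist A B D).Point, canonicalHeight (P + Q) + canonicalHeight (P - Q) =
        2 * canonicalHeight P + 2 * canonicalHeight Q) ∧
      (∀ P : (twist A B D).Point, 0 ≤ canonicalHeight P) ∧
      ∀ P : (twist A B D).Point, |untwistedHeight P - canonicalHeight P| ≤ C := by
  obtain ⟨C, hC⟩ := exists_approx_parallelogram A B h
  refine ⟨C, fun D hD ↦ ?_⟩
  have hlim (P : (twist A B D).Point) :
      Tendsto (fun n : ℕ ↦ untwistedHeight ((2 ^ n : ℕ) • P) / (4 : ℝ) ^ n) atTop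
        (𝓝 (canonicalHeight P)) ∧ |untwistedHeight P - canonicalHeight P| ≤ C := by
    obtain ⟨l, hl, hb⟩ := exists_tendsto_of_approx_parallelogram untwistedHeight_zero (hC D hD) P
    -- The two heights differ by at most h(D), which is fixed along the sequence, so division by 4ⁿ
    -- removes it.
    have hzero : Tendsto (fun n : ℕ ↦ (weilHeight ((2 ^ n : ℕ) • P) -
        untwistedHeight ((2 ^ n : ℕ) • P)) / (4 : ℝ) ^ n) atTop (𝓝 0) := by
      refine squeeze_zero_norm (a := fun n ↦ logHeight₁ (D : ℚ) / (4 : ℝ) ^ n) (fun n ↦ ?_)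
        (tendsto_const_nhds.div_atTop (tendsto_pow_atTop_atTop_of_one_lt (by norm_num)))
      rw [norm_div, Real.norm_eq_abs, norm_pow, Real.norm_ofNat]
      gcongr
      exact abs_weilHeight_sub_untwistedHeight_le hD _
    have : canonicalHeight P = l := by
      refine Tendsto.limUnder_eq ?_
      have := hl.add hzero
      rw [add_zero] at this
      refine this.congr fun n ↦ ?_
      ring
    rw [this]
    exact ⟨hl, hb⟩
  refine ⟨parallelogram_of_tendsto (hC D hD) fun P ↦ (hlim P).1,
    fun P ↦ ge_of_tendsto' (hlim P).1 fun n ↦ ?_, fun P ↦ (hlim P).2⟩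
  exact div_nonneg (logHeight_nonneg _) (by positivity)

end QuadraticTwist

/-! ### The main theorem. -/

theorem proposition5p1 :
    ∃ C : ℕ, ∀ A B : ℤ, 4 * A ^ 3 + 27 * B ^ 2 ≠ 0 →
      ∃ D₀ : ℤ, ∀ D : ℤ, 0 < D → Squarefree D → D₀ ≤ D →
        (QuadraticTwist.smallIntegralPoints A B D).Finite ∧
        Cardinal.mk (QuadraticTwist.smallIntegralPoints A B D) ≤
          (C : Cardinal) * 4 ^ QuadraticTwist.mordellWeilRank A B D ∧
        (QuadraticTwist.smallRationalPoints A B D).Finite ∧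
        Cardinal.mk (QuadraticTwist.smallRationalPoints A B D) ≤
          (C : Cardinal) * 4 ^ QuadraticTwist.mordellWeilRank A B D := by
  open QuadraticTwist in
  refine ⟨64, fun A B hAB ↦ ?_⟩
  obtain ⟨C, hC⟩ := exists_canonicalHeight_bounds A B hAB
  set K : ℝ := Real.log (1 + |A| + |B|) with hK
  -- With c = (log D)/4 - k and R = 1.5 log D, the condition 5R < 32c reads log D > 64k, where k =
  -- K/4 + |C|.
  refine ⟨⌈Real.exp (64 * (K / 4 + |C|) + 1)⌉, fun D hD hsq hD₀ ↦ ?_⟩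
  have hK₀ : 0 ≤ K := Real.log_nonneg (by
    have : (0 : ℝ) ≤ |(A : ℝ)| + |(B : ℝ)| := by positivity
    push_cast
    linarith)
  have hlog : 64 * (K / 4 + |C|) + 1 ≤ Real.log D := by
    rw [Real.le_log_iff_exp_le (mod_cast hD)]
    exact Int.ceil_le.mp hD₀
  obtain ⟨hq, hq₀, hb⟩ := hC D hD.ne'
  have hlow (P : (twist A B D).Point) (hP : P + P ≠ 0) :
      Real.log D / 4 - (K / 4 + |C|) ≤ canonicalHeight P := by
    have h₁ := log_le_untwistedHeight hD hsq hP
    have h₂ := (abs_le.mp (hb P)).2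
    have h₃ := le_abs_self C
    rw [← hK] at h₁
    linarith
  have hfin : (smallRationalPoints A B D).Finite := by
    refine (finite_weilHeight_le (1.5 * Real.log D + C + Height.logHeight₁ (D : ℚ))).subset
      fun P hP ↦ ?_
    have h₁ := (abs_le.mp (hb P)).2
    have h₂ := (abs_le.mp (abs_weilHeight_sub_untwistedHeight_le hD.ne' P)).2
    have h₃ : canonicalHeight P ≤ 1.5 * Real.log D := hP
    simp only [Set.mem_ofPred_eq]
    linarith
  have hsub : smallIntegralPoints A B D ⊆ smallRationalPoints A B D := fun P hP ↦ hP.2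
  have hC₀ := abs_nonneg C
  have hcard : Cardinal.mk (smallRationalPoints A B D) ≤
      ((64 : ℕ) : Cardinal) * 4 ^ mordellWeilRank A B D := by
    have := card_le_of_parallelogram hq hq₀ (c := Real.log D / 4 - (K / 4 + |C|))
      (R := 1.5 * Real.log D) (by linarith) hlow (by linarith)
      finite_and_ncard_two_torsion_le.1 finite_and_ncard_two_torsion_le.2 hfin.toFinset
      fun P hP ↦ hfin.mem_toFinset.mp hP
    rw [← Set.ncard_eq_toFinset_card _ hfin, Set.cast_ncard hfin] at this
    exact_mod_cast this
  exact ⟨hfin.subset hsub, (Cardinal.mk_le_mk_of_subset hsub).trans hcard, hfin, hcard⟩
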